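/- Let $(a_n)_{n\in\mathbb{Z}}$ be independent, identically distributed real random variables on a probability space $(\Omega,\mathcal F,\mathbb P)$ with common law $P_0$ satisfying $$0<\inf\operatorname{supp}P_0<\sup\operatorname{supp}P_0<\infty .$$ Let $H_\omega$ be the random Jacobi operator on $\ell^2(\mathbb{Z};\mathbb{C})$ given by $$(H_\omega\phi)_n=-a_{n+1}(\omega)\,\phi_{n+1}+\big(a_{n+1}(\omega)+a_n(\omega)\big)\phi_n-a_n(\omega)\,\phi_{n-1},$$ which is almost surely bounded and self-adjoint, and for $q>0$ and $T>0$ let $$M_T^q=\int_0^\infty \frac{dt}{T}\,e^{-t/T}\sum_{n\in\mathbb{Z}}|n|^q\,\big|\langle\delta_n,e^{-itH_\omega}\delta_0\rangle\big|^2 ,$$ where $(\delta_n)_{n\in\mathbb{Z}}$ is the standard basis of $\ell^2(\mathbb{Z};\mathbb{C})$. Then for every $q\ge 11/2$, almost surely, $M_T^q$ is finite for all $T>0$ and $$\liminf_{T\to\infty}\frac{\log M_T^q}{q\log T}\ \ge\ \frac25-\frac{11}{5q}.$$ -/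

import Mathlib

open MeasureTheory ProbabilityTheory Filter
open scoped ENNReal

noncomputable section

/-- The Hilbert space `ℓ²(ℤ; ℂ)`. -/
abbrev EllTwo : Type := lp (fun _ : ℤ => ℂ) 2

/-- The Kronecker delta `δ_n`, as a vector of `ℓ²(ℤ)`. -/
def kdelta (n : ℤ) : EllTwo := lp.single 2 n (1 : ℂ)

/-- The divergence-gradient difference expression
`(H φ)_n = -a_{n+1} φ_{n+1} + (a_{n+1} + a_n) φ_n - a_n φ_{n-1}` on arbitrary sequences. -/
def divGradExpr (a : ℤ → ℝ) (φ : ℤ → ℂ) (n : ℤ) : ℂ :=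
  -(a (n + 1) : ℂ) * φ (n + 1) + ((a (n + 1) : ℂ) + (a n : ℂ)) * φ n - (a n : ℂ) * φ (n - 1)

theorem memlp_shift (φ : EllTwo) (k : ℤ) :
    Memℓp (fun n : ℤ => (φ (n + k) : ℂ)) 2 := by
  have h := lp.memℓp φ
  rw [memℓp_gen_iff (by norm_num)] at h ⊢
  exact (Equiv.addRight k).summable_iff.2 h

/-- The shift `φ ↦ (φ_{n+k})_n` on `ℓ²(ℤ)`; used only to bound the norm of `divGrad`. -/
def shiftVec (k : ℤ) (φ : EllTwo) : EllTwo := ⟨fun n : ℤ => φ (n + k), memlp_shift φ k⟩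

theorem norm_shiftVec (k : ℤ) (φ : EllTwo) : ‖shiftVec k φ‖ = ‖φ‖ := by
  rw [lp.norm_eq_tsum_rpow (by norm_num), lp.norm_eq_tsum_rpow (by norm_num)]
  congr 1
  exact (Equiv.addRight k).tsum_eq (fun n : ℤ => ‖φ n‖ ^ (2 : ℝ≥0∞).toReal)

theorem norm_divGradExpr_le {a : ℤ → ℝ} {C : ℝ} (ha : ∀ n, |a n| ≤ C) (φ : ℤ → ℂ) (n : ℤ) :
    ‖divGradExpr a φ n‖ ≤ C * ‖φ (n + 1)‖ + 2 * C * ‖φ n‖ + C * ‖φ (n + -1)‖ := by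
  have h (m : ℤ) : ‖(a m : ℂ)‖ ≤ C := by simpa using ha m
  unfold divGradExpr
  refine (norm_sub_le _ _).trans (add_le_add ((norm_add_le _ _).trans (add_le_add ?_ ?_)) ?_)
  · rw [norm_mul, norm_neg]
    exact mul_le_mul_of_nonneg_right (h _) (norm_nonneg _)
  · rw [norm_mul]
    refine mul_le_mul_of_nonneg_right ((norm_add_le _ _).trans ?_) (norm_nonneg _)
    linarith [h (n + 1), h n]
  · rw [norm_mul, ← sub_eq_add_neg]
    exact mul_le_mul_of_nonneg_right (h _) (norm_nonneg _)

/-- The sequence of moduli `(|φ_n|)_n` of a vector of `ℓ²(ℤ)`. -/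
def absVec (φ : EllTwo) : lp (fun _ : ℤ => ℝ) 2 :=
  ⟨fun n : ℤ => ‖φ n‖, (lp.memℓp φ).norm⟩

theorem norm_absVec (φ : EllTwo) : ‖absVec φ‖ = ‖φ‖ := by
  rw [lp.norm_eq_tsum_rpow (by norm_num), lp.norm_eq_tsum_rpow (by norm_num)]
  simp [absVec]

theorem memlp_divGradExpr {a : ℤ → ℝ} {C : ℝ} (ha : ∀ n, |a n| ≤ C) (φ : EllTwo) :
    Memℓp (divGradExpr a φ) 2 :=
  Memℓp.mono (lp.memℓp (C • absVec (shiftVec 1 φ) + (2 * C) • absVec φ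
    + C • absVec (shiftVec (-1) φ))) (fun n => norm_divGradExpr_le ha φ n)

/-- The difference expression with bounded coefficients, as a linear map on `ℓ²(ℤ)`. -/
def divGradLin (a : ℤ → ℝ) (ha : ∃ C : ℝ, ∀ n, |a n| ≤ C) : EllTwo →ₗ[ℂ] EllTwo where
  toFun φ := ⟨divGradExpr a φ, memlp_divGradExpr ha.choose_spec φ⟩
  map_add' φ ψ := by
    ext n
    simp only [divGradExpr, lp.coeFn_add, Pi.add_apply]
    ring
  map_smul' c φ := by
    ext n
    simp only [divGradExpr, lp.coeFn_smul, Pi.smul_apply, smul_eq_mul, RingHom.id_apply]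
    ring

theorem divGradLin_bound (a : ℤ → ℝ) (ha : ∃ C : ℝ, ∀ n, |a n| ≤ C) :
    ∃ B : ℝ, ∀ φ : EllTwo, ‖divGradLin a ha φ‖ ≤ B * ‖φ‖ := by
  obtain ⟨C, hC⟩ := id ha
  have hC0 : 0 ≤ C := (abs_nonneg _).trans (hC 0)
  refine ⟨4 * C, fun φ => ?_⟩
  have h1 : ‖divGradLin a ha φ‖ ≤ ‖C • absVec (shiftVec 1 φ) + (2 * C) • absVec φ
      + C • absVec (shiftVec (-1) φ)‖ :=
    lp.norm_mono (by norm_num) fun n =>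
      (norm_divGradExpr_le hC φ n).trans (le_abs_self _)
  refine h1.trans ((norm_add_le _ _).trans ((add_le_add (norm_add_le _ _) le_rfl).trans ?_))
  simp only [norm_smul, norm_absVec, norm_shiftVec, Real.norm_eq_abs, abs_of_nonneg hC0,
    abs_of_nonneg (mul_nonneg zero_le_two hC0)]
  linarith

open Classical in
/-- The divergence-gradient operator `H` on `ℓ²(ℤ)` with coefficient sequence `a`: a bounded
operator whenever `a` is bounded. (For unbounded `a` the value is the dummy `0`.) -/
def divGrad (a : ℤ → ℝ) : EllTwo →L[ℂ] EllTwo :=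
  if ha : ∃ C : ℝ, ∀ n, |a n| ≤ C then
    (divGradLin a ha).mkContinuousOfExistsBound (divGradLin_bound a ha)
  else 0

theorem divGrad_apply {a : ℤ → ℝ} (ha : ∃ C : ℝ, ∀ n, |a n| ≤ C) (φ : EllTwo) (n : ℤ) :
    divGrad a φ n = -(a (n + 1) : ℂ) * φ (n + 1) + ((a (n + 1) : ℂ) + (a n : ℂ)) * φ n
      - (a n : ℂ) * φ (n - 1) := by
  rw [divGrad, dif_pos ha]
  rfl

/-- The unitary group `e^{-itH}` of the bounded operator `H = divGrad a`. -/
def evolution (a : ℤ → ℝ) (t : ℝ) : EllTwo →L[ℂ] EllTwo :=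
  NormedSpace.exp ((-(Complex.I * (t : ℂ))) • divGrad a)

/-- The time-averaged moment
`M_T^q = ∫_0^∞ (dt/T) e^{-t/T} ∑_{n ∈ ℤ} |n|^q |⟨δ_n, e^{-itH} δ_0⟩|²`, as a value in `[0, ∞]`. -/
def timeAvgMoment (a : ℤ → ℝ) (q T : ℝ) : ℝ≥0∞ :=
  ∫⁻ t in Set.Ioi (0 : ℝ), ENNReal.ofReal (T⁻¹ * Real.exp (-t / T)) *
    ∑' n : ℤ, ENNReal.ofReal
      (|(n : ℝ)| ^ q * ‖inner ℂ (kdelta n) (evolution a t (kdelta 0))‖ ^ 2)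

end

/-!
Write `M_T^q` as an expectation over an exponential time `τ` of mean `T`. By Jensen's inequality on
each coordinate it dominates the `q`-th moment of the averaged wave `u = E[e^{-iτH} δ₀]`, which
solves the resolvent equation `u + iTHu = δ₀`. Pairing this equation with `u` gives
`‖u‖² ≤ |u₀|` and, by ellipticity, `mT ‖∂u‖² ≤ |u₀|`; the Agmon inequality `|u₀|² ≤ 2 ‖u‖ ‖∂u‖`
then forces `‖u‖² ≤ 2 / √(mT)`. On the other hand `H` is a divergence, so summing the equation over
`ℤ` gives `∑ u_n = 1`. Carlson's inequality turns unit mass and small `ℓ²` norm into spreading over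
the diffusive scale `√T`, so `M_T^q` grows at least like `T^{(q-1)/2}`, and the exponent
`1/2 - 1/(2q)` obtained in this way is at least `2/5 - 11/(5q)`.
-/

theorem inner_kdelta_left (n : ℤ) (φ : EllTwo) : inner ℂ (kdelta n) φ = φ n := by
  simp [kdelta, lp.inner_single_left]

theorem norm_kdelta (n : ℤ) : ‖kdelta n‖ = 1 := by
  simp [kdelta, lp.norm_single]

theorem kdelta_apply (n k : ℤ) : kdelta n k = if k = n then 1 else 0 := by
  simp [kdelta, lp.single_apply, Pi.single_apply]

theorem inner_shiftVec_right (k : ℤ) (φ ψ : EllTwo) :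
    inner ℂ φ (shiftVec k ψ) = inner ℂ (shiftVec (-k) φ) ψ := by
  rw [lp.inner_eq_tsum, lp.inner_eq_tsum,
    ← (Equiv.addRight k).tsum_eq fun n => inner ℂ (shiftVec (-k) φ n) (ψ n)]
  simp [shiftVec]

/-- The backward difference `(∂φ)_n = φ_n - φ_{n-1}` on `ℓ²(ℤ)`. -/
noncomputable def backDiff (φ : EllTwo) : EllTwo := φ - shiftVec (-1) φ

theorem abs_norm_sq_sub_norm_sq_le {E : Type*} [SeminormedAddCommGroup E] (x y : E) :
    |‖x‖ ^ 2 - ‖y‖ ^ 2| ≤ (‖x‖ + ‖y‖) * ‖x - y‖ := by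
  rw [sq_sub_sq, abs_mul, abs_of_nonneg (by positivity)]
  gcongr
  exact abs_norm_sub_norm_le x y

/-- A discrete Agmon inequality. -/
theorem norm_apply_sq_le_norm_mul_norm_backDiff (φ : EllTwo) (n : ℤ) :
    ‖φ n‖ ^ 2 ≤ 2 * ‖φ‖ * ‖backDiff φ‖ := by
  set g : ℤ → ℝ := fun k => (‖φ k‖ + ‖φ (k - 1)‖) * ‖backDiff φ k‖
  have hg : HasSum g (inner ℝ (absVec φ + absVec (shiftVec (-1) φ)) (absVec (backDiff φ))) := by
    refine (lp.hasSum_inner (𝕜 := ℝ) _ _).congr_fun fun k => ?_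
    exact mul_comm _ _
  have hinj : Function.Injective fun j : ℕ => n - (j : ℤ) := fun i j h => by simpa using h
  have hlim : Tendsto (fun j : ℕ => ‖φ (n - j)‖ ^ 2) atTop (nhds 0) := by
    have h : Summable fun k => ‖φ k‖ ^ 2 := by simpa using (lp.memℓp φ).summable (by norm_num)
    exact (h.comp_injective hinj).tendsto_atTop_zero
  calc ‖φ n‖ ^ 2 ≤ ∑' j : ℕ, g (n - j) := by
        have h := dist_le_tsum_of_dist_le_of_tendsto₀ (fun j : ℕ => g (n - j)) (fun j => ?_)
          (hg.summable.comp_injective hinj) hlim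
        · simpa using h
        · rw [Nat.cast_succ, ← sub_sub]
          exact abs_norm_sq_sub_norm_sq_le _ _
    _ ≤ ∑' k, g k := tsum_comp_le_tsum_of_inj hg.summable (fun k => by positivity) hinj
    _ ≤ ‖absVec φ + absVec (shiftVec (-1) φ)‖ * ‖absVec (backDiff φ)‖ :=
        hg.tsum_eq ▸ real_inner_le_norm _ _
    _ ≤ (‖absVec φ‖ + ‖absVec (shiftVec (-1) φ)‖) * ‖absVec (backDiff φ)‖ := by
        gcongr
        exact norm_add_le _ _
    _ = 2 * ‖φ‖ * ‖backDiff φ‖ := by simp only [norm_absVec, norm_shiftVec]; ring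

section DivGrad

variable {a : ℤ → ℝ}

theorem memlp_mul_backDiff (ha : ∃ C : ℝ, ∀ n, |a n| ≤ C) (φ : EllTwo) :
    Memℓp (fun n => (a n : ℂ) * backDiff φ n) 2 := by
  obtain ⟨C, hC⟩ := ha
  refine Memℓp.mono (lp.memℓp (C • absVec (backDiff φ))) fun n => ?_
  rw [norm_mul, Complex.norm_real]
  exact mul_le_mul_of_nonneg_right (hC n) (norm_nonneg _)

/-- The flux `(a ∂φ)_n = a_n (φ_n - φ_{n-1})` of `φ` across the bonds of `ℤ`. -/
noncomputable def flux (ha : ∃ C : ℝ, ∀ n, |a n| ≤ C) (φ : EllTwo) : EllTwo :=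
  ⟨fun n => (a n : ℂ) * backDiff φ n, memlp_mul_backDiff ha φ⟩

theorem divGrad_eq_flux_sub_shiftVec (ha : ∃ C : ℝ, ∀ n, |a n| ≤ C) (φ : EllTwo) :
    divGrad a φ = flux ha φ - shiftVec 1 (flux ha φ) := by
  ext n
  change _ = (a n : ℂ) * (φ n - φ (n - 1)) - (a (n + 1) : ℂ) * (φ (n + 1) - φ (n + 1 - 1))
  rw [divGrad_apply ha, add_sub_cancel_right]
  ring

theorem inner_divGrad_right (ha : ∃ C : ℝ, ∀ n, |a n| ≤ C) (φ ψ : EllTwo) :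
    inner ℂ φ (divGrad a ψ) = inner ℂ (backDiff φ) (flux ha ψ) := by
  rw [divGrad_eq_flux_sub_shiftVec ha, inner_sub_right, inner_shiftVec_right, backDiff,
    inner_sub_left]

theorem inner_backDiff_flux_comm (ha : ∃ C : ℝ, ∀ n, |a n| ≤ C) (φ ψ : EllTwo) :
    inner ℂ (backDiff φ) (flux ha ψ) = inner ℂ (flux ha φ) (backDiff ψ) := by
  rw [lp.inner_eq_tsum, lp.inner_eq_tsum]
  refine tsum_congr fun n => ?_
  simp only [flux, RCLike.inner_apply, map_mul, Complex.conj_ofReal]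
  ring

theorem isSelfAdjoint_divGrad (ha : ∃ C : ℝ, ∀ n, |a n| ≤ C) : IsSelfAdjoint (divGrad a) := by
  refine ContinuousLinearMap.isSelfAdjoint_iff_isSymmetric.2 fun φ ψ => ?_
  change inner ℂ (divGrad a φ) ψ = inner ℂ φ (divGrad a ψ)
  rw [inner_divGrad_right ha, inner_backDiff_flux_comm, ← inner_conj_symm, inner_divGrad_right ha,
    inner_conj_symm]

theorem mul_norm_backDiff_sq_le_re_inner_divGrad {m : ℝ} (ha : ∃ C : ℝ, ∀ n, |a n| ≤ C)
    (hm : ∀ n, m ≤ a n) (φ : EllTwo) :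
    m * ‖backDiff φ‖ ^ 2 ≤ (inner ℂ φ (divGrad a φ)).re := by
  have hnorm : HasSum (fun n => ‖backDiff φ n‖ ^ 2) (‖backDiff φ‖ ^ 2) := by
    simpa using lp.hasSum_norm (p := 2) (by norm_num) (backDiff φ)
  have hinner := Complex.hasSum_re (lp.hasSum_inner (𝕜 := ℂ) (backDiff φ) (flux ha φ))
  rw [inner_divGrad_right ha]
  refine hasSum_le (fun n => ?_) (hnorm.mul_left m) hinner
  have h : inner ℂ (backDiff φ n) (flux ha φ n) = ((a n * ‖backDiff φ n‖ ^ 2 : ℝ) : ℂ) := by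
    simp only [flux, RCLike.inner_apply, mul_assoc, Complex.mul_conj']
    push_cast
    rfl
  rw [h, Complex.ofReal_re]
  gcongr
  exact hm n

theorem hasSum_divGrad_zero (ha : ∃ C : ℝ, ∀ n, |a n| ≤ C) {φ : EllTwo} (hφ : Summable φ) :
    HasSum (divGrad a φ) 0 := by
  have hshift {f : ℤ → ℂ} {s : ℂ} (k : ℤ) (hf : HasSum f s) : HasSum (fun n => f (n + k)) s :=
    (Equiv.addRight k).hasSum_iff.2 hf
  have hflux : Summable (flux ha φ) := by
    obtain ⟨C, hC⟩ := ha
    have hdiff : Summable (backDiff φ) := hφ.sub (hshift (-1) hφ.hasSum).summable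
    refine Summable.of_norm_bounded (hdiff.norm.mul_left C) fun n => ?_
    rw [flux, norm_mul, Complex.norm_real]
    exact mul_le_mul_of_nonneg_right (hC n) (norm_nonneg _)
  rw [divGrad_eq_flux_sub_shiftVec ha, ← sub_self (∑' n, flux ha φ n)]
  exact hflux.hasSum.sub (hshift 1 hflux.hasSum)

end DivGrad

section ExponentialTime

theorem expMeasure_eq_withDensity (r : ℝ) :
    expMeasure r = (volume.restrict (Set.Ioi 0)).withDensity
      fun t => ENNReal.ofReal (r * Real.exp (-(r * t))) := by
  rw [Measure.restrict_congr_set Ioi_ae_eq_Ici, ← withDensity_indicator measurableSet_Ici]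
  change volume.withDensity (exponentialPDF r) = _
  congr 1 with t
  rw [exponentialPDF_eq, Set.indicator_apply]
  split_ifs <;> simp_all only [Set.mem_Ici, not_true_eq_false, not_false_eq_true]
  simp

theorem ae_expMeasure_pos (r : ℝ) : ∀ᵐ t ∂expMeasure r, 0 < t := by
  rw [expMeasure_eq_withDensity]
  exact (withDensity_absolutelyContinuous _ _).ae_le (ae_restrict_mem measurableSet_Ioi)

theorem lintegral_expMeasure (r : ℝ) (f : ℝ → ℝ≥0∞) :
    ∫⁻ t, f t ∂expMeasure r
      = ∫⁻ t in Set.Ioi 0, ENNReal.ofReal (r * Real.exp (-(r * t))) * f t := by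
  rw [expMeasure_eq_withDensity, lintegral_withDensity_eq_lintegral_mul_non_measurable _
    (by fun_prop) (ae_of_all _ fun _ => ENNReal.ofReal_lt_top)]
  rfl

theorem lintegral_exp_mul_expMeasure_lt_top {r s : ℝ} (hsr : s < r) :
    ∫⁻ t, ENNReal.ofReal (Real.exp (s * t)) ∂expMeasure r < ∞ := by
  have hint : IntegrableOn (fun t : ℝ => r * Real.exp ((s - r) * t)) (Set.Ioi 0) :=
    (integrableOn_exp_mul_Ioi (sub_neg.2 hsr) 0).const_mul r
  rw [lintegral_expMeasure]
  refine lt_of_eq_of_lt (lintegral_congr fun t => ?_) hint.lintegral_lt_top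
  rw [← ENNReal.ofReal_mul' (by positivity), mul_assoc, ← Real.exp_add]
  ring_nf

variable {E : Type*} [NormedAddCommGroup E] [NormedSpace ℝ E] {r : ℝ}

theorem integrable_expMeasure_iff (hr : 0 < r) {f : ℝ → E} :
    Integrable f (expMeasure r) ↔
      IntegrableOn (fun t => Real.exp (-(r * t)) • f t) (Set.Ioi 0) := by
  rw [expMeasure_eq_withDensity, integrable_withDensity_iff_integrable_smul' (by fun_prop)
    (ae_of_all _ fun _ => ENNReal.ofReal_lt_top), IntegrableOn,
    ← integrable_smul_iff hr.ne' (fun t => Real.exp (-(r * t)) • f t)]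
  refine integrable_congr (ae_of_all _ fun t => ?_)
  simp only [Pi.smul_apply, smul_smul]
  rw [ENNReal.toReal_ofReal (by positivity)]

theorem integral_expMeasure (hr : 0 < r) (f : ℝ → E) :
    ∫ t, f t ∂expMeasure r = r • ∫ t in Set.Ioi 0, Real.exp (-(r * t)) • f t := by
  rw [expMeasure_eq_withDensity, integral_withDensity_eq_integral_toReal_smul (by fun_prop)
    (ae_of_all _ fun _ => ENNReal.ofReal_lt_top), ← integral_smul]
  refine integral_congr_ae (ae_of_all _ fun t => ?_)
  simp only [smul_smul]
  rw [ENNReal.toReal_ofReal (by positivity)]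

theorem integral_expMeasure_of_hasDerivAt [CompleteSpace E] (hr : 0 < r) {f f' : ℝ → E}
    (hderiv : ∀ t ∈ Set.Ici 0, HasDerivAt f (f' t) t) (hf : Integrable f (expMeasure r))
    (hf' : Integrable f' (expMeasure r)) :
    ∫ t, f' t ∂expMeasure r = r • (∫ t, f t ∂expMeasure r - f 0) := by
  rw [integral_expMeasure hr, integral_expMeasure hr]
  rw [integrable_expMeasure_iff hr] at hf hf'
  have hprod : ∀ t ∈ Set.Ici 0, HasDerivAt (fun t => Real.exp (-(r * t)) • f t)
      (Real.exp (-(r * t)) • f' t - r • Real.exp (-(r * t)) • f t) t := fun t ht => by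
    have hexp : HasDerivAt (fun t => Real.exp (-(r * t))) (Real.exp (-(r * t)) * -r) t := by
      simpa using ((hasDerivAt_id t).const_mul r).neg.exp
    refine (hexp.smul (hderiv t ht)).congr_deriv ?_
    module
  have hint : IntegrableOn
      (fun t => Real.exp (-(r * t)) • f' t - r • Real.exp (-(r * t)) • f t) (Set.Ioi 0) :=
    hf'.sub (hf.smul r)
  have hlim := tendsto_zero_of_hasDerivAt_of_integrableOn_Ioi
    (fun t ht => hprod t (Set.Ioi_subset_Ici_self ht)) hint hf
  have hftc := integral_Ioi_of_hasDerivAt_of_tendsto' hprod hint hlim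
  rw [integral_sub hf' (hf.fun_smul r), integral_smul, mul_zero, neg_zero, Real.exp_zero, one_smul,
    zero_sub, sub_eq_iff_eq_add] at hftc
  rw [hftc]
  module

end ExponentialTime

theorem enorm_integral_sq_le_lintegral {α E : Type*} [MeasurableSpace α] {μ : Measure α}
    [IsProbabilityMeasure μ] [NormedAddCommGroup E] [NormedSpace ℝ E] {f : α → E}
    (hf : AEStronglyMeasurable f μ) : ‖∫ x, f x ∂μ‖ₑ ^ 2 ≤ ∫⁻ x, ‖f x‖ₑ ^ 2 ∂μ := by
  have h : ‖∫ x, f x ∂μ‖ₑ ≤ eLpNorm f 2 μ := by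
    refine (enorm_integral_le_lintegral_enorm f).trans ?_
    rw [← eLpNorm_one_eq_lintegral_enorm]
    exact eLpNorm_le_eLpNorm_of_exponent_le one_le_two hf
  calc ‖∫ x, f x ∂μ‖ₑ ^ 2 ≤ eLpNorm f 2 μ ^ 2 := by gcongr
    _ = ∫⁻ x, ‖f x‖ₑ ^ 2 ∂μ := by
      simpa using eLpNorm_nnreal_pow_eq_lintegral (f := f) (μ := μ) (p := 2) two_ne_zero

section ResolventEquation

variable {E : Type*} [NormedAddCommGroup E] [InnerProductSpace ℂ E] {H : E →L[ℂ] E} {T : ℝ}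
  {u x : E}

theorem norm_sq_add_I_mul_inner_eq (hu : u + (Complex.I * T) • H u = x) :
    (‖u‖ ^ 2 : ℂ) + Complex.I * T * inner ℂ u (H u) = inner ℂ u x := by
  rw [← hu, inner_add_right, inner_smul_right, inner_self_eq_norm_sq_to_K]
  rfl

theorem mul_re_inner_le_norm_inner_of_resolvent_eq (hu : u + (Complex.I * T) • H u = x) :
    T * (inner ℂ u (H u)).re ≤ ‖inner ℂ u x‖ := by
  have him := congrArg Complex.im (norm_sq_add_I_mul_inner_eq hu)
  refine le_of_eq_of_le ?_ ((le_abs_self _).trans (Complex.abs_im_le_norm _))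
  simpa [← Complex.ofReal_pow] using him

theorem norm_sq_le_norm_inner_of_resolvent_eq (hH : H.IsSymmetric)
    (hu : u + (Complex.I * T) • H u = x) : ‖u‖ ^ 2 ≤ ‖inner ℂ u x‖ := by
  have him : (inner ℂ u (H u)).im = 0 := hH.im_inner_self_apply u
  have hre := congrArg Complex.re (norm_sq_add_I_mul_inner_eq hu)
  refine le_of_eq_of_le ?_ (Complex.re_le_norm _)
  simpa [← Complex.ofReal_pow, him] using hre

end ResolventEquation

section ResolventAverage

variable {E : Type*} [NormedAddCommGroup E] [InnerProductSpace ℂ E] [CompleteSpace E]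
  {H : E →L[ℂ] E} {T : ℝ}

theorem norm_exp_neg_I_smul_apply (hH : IsSelfAdjoint H) (t : ℝ) (x : E) :
    ‖NormedSpace.exp ((-(Complex.I * (t : ℂ))) • H) x‖ = ‖x‖ := by
  have hskew : (-(Complex.I * (t : ℂ))) • H ∈ skewAdjoint (E →L[ℂ] E) :=
    hH.smul_mem_skewAdjoint (by simp [skewAdjoint.mem_iff])
  have hu : NormedSpace.exp ((-(Complex.I * (t : ℂ))) • H) ∈ unitary (E →L[ℂ] E) := by
    let +nondep : NormedAlgebra ℚ (E →L[ℂ] E) := NormedAlgebra.restrictScalars ℚ ℂ _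
    exact NormedSpace.exp_mem_unitary_of_mem_skewAdjoint hskew
  exact ContinuousLinearMap.norm_map_of_mem_unitary hu x

theorem hasDerivAt_exp_neg_I_smul_apply (H : E →L[ℂ] E) (x : E) (t : ℝ) :
    HasDerivAt (fun s : ℝ => NormedSpace.exp ((-(Complex.I * (s : ℂ))) • H) x)
      (-(Complex.I • H (NormedSpace.exp ((-(Complex.I * (t : ℂ))) • H) x))) t := by
  have hscalar : HasDerivAt (fun s : ℝ => -(Complex.I * (s : ℂ))) (-Complex.I) t := by
    simpa using (Complex.ofRealCLM.hasDerivAt.const_mul Complex.I).fun_neg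
  have hexp := (hasDerivAt_exp_smul_const' (𝕂 := ℂ) H (-(Complex.I * (t : ℂ)))).scomp t hscalar
  refine (((ContinuousLinearMap.apply ℂ E x).restrictScalars ℝ).hasFDerivAt.comp_hasDerivAt
    t hexp).congr_deriv ?_
  simp

theorem continuous_exp_neg_I_smul_apply (H : E →L[ℂ] E) (x : E) :
    Continuous fun t : ℝ => NormedSpace.exp ((-(Complex.I * (t : ℂ))) • H) x :=
  continuous_iff_continuousAt.2 fun t => (hasDerivAt_exp_neg_I_smul_apply H x t).continuousAt

/-- The wave `∫₀^∞ (dt/T) e^{-t/T} e^{-itH} x`, that is, the evolution of `x` averaged over an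
exponentially distributed time of mean `T`. -/
noncomputable def avgWave (H : E →L[ℂ] E) (T : ℝ) (x : E) : E :=
  ∫ t : ℝ, NormedSpace.exp ((-(Complex.I * (t : ℂ))) • H) x ∂expMeasure T⁻¹

theorem integrable_exp_neg_I_smul_apply (hH : IsSelfAdjoint H) (hT : 0 < T) (x : E) :
    Integrable (fun t : ℝ => NormedSpace.exp ((-(Complex.I * (t : ℂ))) • H) x)
      (expMeasure T⁻¹) := by
  have := isProbabilityMeasure_expMeasure (inv_pos.2 hT)
  exact Integrable.of_bound (continuous_exp_neg_I_smul_apply H x).aestronglyMeasurable ‖x‖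
    (ae_of_all _ fun t => (norm_exp_neg_I_smul_apply hH t x).le)

theorem avgWave_add_smul_apply (hH : IsSelfAdjoint H) (hT : 0 < T) (x : E) :
    avgWave H T x + (Complex.I * T) • H (avgWave H T x) = x := by
  have hint := integrable_exp_neg_I_smul_apply hH hT x
  have h := integral_expMeasure_of_hasDerivAt (inv_pos.2 hT)
    (fun t _ => hasDerivAt_exp_neg_I_smul_apply H x t) hint
    ((Complex.I • H).integrable_comp hint).neg
  rw [integral_neg, integral_smul, H.integral_comp_comm hint] at h
  have hx : avgWave H T x = x + T • -(Complex.I • H (avgWave H T x)) := by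
    rw [avgWave, h, smul_inv_smul₀ hT.ne']
    simp
  nth_rw 1 [hx]
  rw [RCLike.real_smul_eq_coe_smul (K := ℂ)]
  module

end ResolventAverage

section IntegralTest

variable {f : ℝ → ℝ}

theorem summable_int_comp_abs (hf : Summable fun n : ℕ => f n) :
    Summable fun n : ℤ => f |(n : ℝ)| :=
  Summable.of_nat_of_neg (by simpa using hf) (by simpa using hf)

theorem tsum_int_comp_abs_le_integral (anti : AntitoneOn f (Set.Ici 0))
    (integrable : IntegrableOn f (Set.Ioi 0)) (nonneg : ∀ t ∈ Set.Ioi 0, 0 ≤ f t) :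
    ∑' n : ℤ, f |(n : ℝ)| ≤ f 0 + 2 * ∫ t in Set.Ioi 0, f t := by
  have hf := anti.summable_of_integrableOn_Ioi_zero integrable nonneg
  have h := Summable.tsum_of_nat_of_neg (f := fun n : ℤ => f |(n : ℝ)|)
    (by simpa using hf) (by simpa using hf)
  simp only [Int.cast_natCast, Int.cast_neg, abs_neg, Nat.abs_cast, Int.cast_zero, abs_zero] at h
  linarith [anti.tsum_le_integral integrable nonneg]

end IntegralTest

theorem summable_and_tsum_sq_le_tsum_inv_mul_tsum {ι : Type*} {w x : ι → ℝ} (hw : ∀ i, 0 < w i)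
    (hx : ∀ i, 0 ≤ x i) (hw' : Summable fun i => (w i)⁻¹)
    (hwx : Summable fun i => w i * x i ^ 2) :
    Summable x ∧ (∑' i, x i) ^ 2 ≤ (∑' i, (w i)⁻¹) * ∑' i, w i * x i ^ 2 := by
  have hinv (i : ι) : √(w i)⁻¹ ^ (2 : ℝ) = (w i)⁻¹ := by
    rw [Real.rpow_two, Real.sq_sqrt (inv_nonneg.2 (hw i).le)]
  have hmul (i : ι) : (√(w i) * x i) ^ (2 : ℝ) = w i * x i ^ 2 := by
    rw [Real.rpow_two, mul_pow, Real.sq_sqrt (hw i).le]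
  have hcancel (i : ι) : √(w i)⁻¹ * (√(w i) * x i) = x i := by
    rw [Real.sqrt_inv, inv_mul_cancel_left₀ (Real.sqrt_pos.2 (hw i)).ne']
  have h := Real.summable_and_inner_le_Lp_mul_Lq_tsum_of_nonneg Real.HolderConjugate.two_two
    (f := fun i => √(w i)⁻¹) (g := fun i => √(w i) * x i) (fun i => Real.sqrt_nonneg _)
    (fun i => mul_nonneg (Real.sqrt_nonneg _) (hx i)) (by simpa only [hinv])
    (by simpa only [hmul])
  simp only [hinv, hmul, hcancel, ← Real.sqrt_eq_rpow] at h
  refine ⟨h.1, ?_⟩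
  rw [← Real.sqrt_le_sqrt_iff, Real.sqrt_sq (tsum_nonneg hx), Real.sqrt_mul]
  · exact h.2
  · exact tsum_nonneg fun i => (inv_pos.2 (hw i)).le
  · exact mul_nonneg (tsum_nonneg fun i => (inv_pos.2 (hw i)).le)
      (tsum_nonneg fun i => mul_nonneg (hw i).le (sq_nonneg _))

section Carlson

variable {q : ℝ}

/-- A constant for Carlson's inequality `summable_and_tsum_sq_le_carlsonConst_mul` with weight
`|n|^q` on `ℤ`. -/
noncomputable def carlsonConst (q : ℝ) : ℝ := 1 + 2 * ∫ x in Set.Ioi (0 : ℝ), (1 + x ^ q)⁻¹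

theorem one_le_carlsonConst (q : ℝ) : 1 ≤ carlsonConst q := by
  have h : 0 ≤ ∫ x in Set.Ioi (0 : ℝ), (1 + x ^ q)⁻¹ :=
    setIntegral_nonneg measurableSet_Ioi fun x hx =>
      inv_nonneg.2 (add_nonneg zero_le_one (Real.rpow_nonneg (le_of_lt hx) q))
  rw [carlsonConst]
  linarith

theorem antitoneOn_inv_one_add_rpow (hq : 0 ≤ q) :
    AntitoneOn (fun x : ℝ => (1 + x ^ q)⁻¹) (Set.Ici 0) := fun x hx y _ hxy => by
  have := Real.rpow_nonneg hx q
  beta_reduce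
  gcongr

theorem integrableOn_inv_one_add_rpow (hq : 1 < q) :
    IntegrableOn (fun x : ℝ => (1 + x ^ q)⁻¹) (Set.Ioi 0) := by
  have hmeas : Measurable fun x : ℝ => (1 + x ^ q)⁻¹ := by fun_prop
  rw [← Set.Ioc_union_Ioi_eq_Ioi zero_le_one]
  refine IntegrableOn.union ?_ ?_
  · refine Integrable.mono' (integrable_const 1) hmeas.aestronglyMeasurable ?_
    filter_upwards [ae_restrict_mem measurableSet_Ioc] with x hx
    have := Real.rpow_nonneg hx.1.le q
    rw [Real.norm_of_nonneg (by positivity)]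
    exact inv_le_one_of_one_le₀ (by linarith)
  · refine Integrable.mono' (integrableOn_Ioi_rpow_of_lt (neg_lt_neg hq) one_pos)
      hmeas.aestronglyMeasurable ?_
    filter_upwards [ae_restrict_mem measurableSet_Ioi] with x hx
    have hxq : 0 < x ^ q := Real.rpow_pos_of_pos (one_pos.trans hx) q
    rw [Real.norm_of_nonneg (by positivity), Real.rpow_neg (one_pos.trans hx).le]
    gcongr
    linarith

theorem summable_inv_weight_and_tsum_le (hq : 1 < q) {R : ℝ} (hR : 1 ≤ R) :
    (Summable fun n : ℤ => (1 + (R⁻¹ * |(n : ℝ)|) ^ q)⁻¹) ∧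
      ∑' n : ℤ, (1 + (R⁻¹ * |(n : ℝ)|) ^ q)⁻¹ ≤ carlsonConst q * R := by
  set f : ℝ → ℝ := fun x => (1 + (R⁻¹ * x) ^ q)⁻¹
  have hR' : 0 < R⁻¹ := inv_pos.2 (one_pos.trans_le hR)
  have hanti : AntitoneOn f (Set.Ici 0) := fun x hx y hy hxy =>
    antitoneOn_inv_one_add_rpow (one_pos.trans hq).le (mul_nonneg hR'.le hx)
      (mul_nonneg hR'.le hy) (mul_le_mul_of_nonneg_left hxy hR'.le)
  have hint : IntegrableOn f (Set.Ioi 0) :=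
    (integrableOn_Ioi_comp_mul_left_iff (fun x => (1 + x ^ q)⁻¹) 0 hR').2 <| by
      simpa using integrableOn_inv_one_add_rpow hq
  have hnonneg : ∀ x ∈ Set.Ioi 0, 0 ≤ f x := fun x hx =>
    inv_nonneg.2 (add_nonneg zero_le_one (Real.rpow_nonneg (mul_pos hR' hx).le q))
  have hval : ∫ x in Set.Ioi 0, f x = R * ∫ x in Set.Ioi (0 : ℝ), (1 + x ^ q)⁻¹ := by
    simpa using integral_comp_mul_left_Ioi (fun x => (1 + x ^ q)⁻¹) 0 hR'
  refine ⟨summable_int_comp_abs (hanti.summable_of_integrableOn_Ioi_zero hint hnonneg), ?_⟩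
  calc ∑' n : ℤ, f |(n : ℝ)| ≤ f 0 + 2 * ∫ x in Set.Ioi 0, f x :=
        tsum_int_comp_abs_le_integral hanti hint hnonneg
    _ = 1 + 2 * (R * ∫ x in Set.Ioi (0 : ℝ), (1 + x ^ q)⁻¹) := by
        rw [hval]
        simp [f, Real.zero_rpow (one_pos.trans hq).ne']
    _ ≤ R + 2 * (R * ∫ x in Set.Ioi (0 : ℝ), (1 + x ^ q)⁻¹) := by gcongr
    _ = carlsonConst q * R := by rw [carlsonConst]; ring

/-- Optimizing over `R` gives Carlson's inequality in its usual multiplicative form. -/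
theorem summable_and_tsum_sq_le_carlsonConst_mul (hq : 1 < q) {R : ℝ} (hR : 1 ≤ R) {x : ℤ → ℝ}
    (hx : ∀ n, 0 ≤ x n) (hsq : Summable fun n => x n ^ 2)
    (hmoment : Summable fun n : ℤ => |(n : ℝ)| ^ q * x n ^ 2) :
    Summable x ∧ (∑' n, x n) ^ 2 ≤ carlsonConst q * R *
      (∑' n, x n ^ 2 + (R ^ q)⁻¹ * ∑' n : ℤ, |(n : ℝ)| ^ q * x n ^ 2) := by
  have hR0 : 0 ≤ R := zero_le_one.trans hR
  have hweight (n : ℤ) : (1 + (R⁻¹ * |(n : ℝ)|) ^ q) * x n ^ 2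
      = x n ^ 2 + (R ^ q)⁻¹ * (|(n : ℝ)| ^ q * x n ^ 2) := by
    rw [Real.mul_rpow (inv_nonneg.2 hR0) (abs_nonneg _), Real.inv_rpow hR0]
    ring
  have hmoment' := hmoment.mul_left (R ^ q)⁻¹
  obtain ⟨hsum, hle⟩ := summable_inv_weight_and_tsum_le hq hR
  obtain ⟨hx', hcs⟩ := summable_and_tsum_sq_le_tsum_inv_mul_tsum
    (w := fun n : ℤ => 1 + (R⁻¹ * |(n : ℝ)|) ^ q) (fun n => by positivity) hx hsum
    (by simpa only [hweight] using hsq.add hmoment')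
  simp only [hweight] at hcs
  rw [hsq.tsum_add hmoment', tsum_mul_left] at hcs
  exact ⟨hx', hcs.trans (by gcongr)⟩

/-- An uncertainty principle: unit mass cannot be spread thinly, in the sense of the `ℓ²` norm,
while keeping the moment small. -/
theorem rpow_sub_one_div_le_tsum_rpow_mul_sq (hq : 1 < q) {R : ℝ} (hR : 1 ≤ R) {x : ℤ → ℝ}
    (hx : ∀ n, 0 ≤ x n) (hsq : Summable fun n => x n ^ 2)
    (hmoment : Summable fun n : ℤ => |(n : ℝ)| ^ q * x n ^ 2) (hmass : 1 ≤ ∑' n, x n)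
    (hspread : carlsonConst q * R * ∑' n, x n ^ 2 ≤ 1 / 2) :
    R ^ (q - 1) / (2 * carlsonConst q) ≤ ∑' n : ℤ, |(n : ℝ)| ^ q * x n ^ 2 := by
  have hR0 : 0 < R := one_pos.trans_le hR
  have hC : 0 < carlsonConst q := one_pos.trans_le (one_le_carlsonConst q)
  set S := ∑' n : ℤ, |(n : ℝ)| ^ q * x n ^ 2
  have hcarlson := (summable_and_tsum_sq_le_carlsonConst_mul hq hR hx hsq hmoment).2
  have hlower : 1 ≤ 2 * carlsonConst q * S * (R * (R ^ q)⁻¹) := by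
    linarith [one_le_pow₀ hmass (n := 2)]
  have hscale : R * (R ^ q)⁻¹ = (R ^ (q - 1))⁻¹ := by
    rw [Real.rpow_sub_one hR0.ne', inv_div, div_eq_mul_inv]
  rw [hscale, ← div_eq_mul_inv, one_le_div (by positivity)] at hlower
  rwa [div_le_iff₀' (by positivity)]

end Carlson

section DivGradResolvent

variable {a : ℤ → ℝ} {m T : ℝ} {u : EllTwo}

theorem norm_apply_zero_mul_sqrt_le_of_resolvent_eq (hm : 0 < m) (ha : ∃ C : ℝ, ∀ n, |a n| ≤ C)
    (hma : ∀ n, m ≤ a n) (hT : 0 < T) (hu : u + (Complex.I * T) • divGrad a u = kdelta 0) :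
    ‖u 0‖ * √(m * T) ≤ 2 := by
  have hsource : ‖inner ℂ u (kdelta 0)‖ = ‖u 0‖ := by
    rw [norm_inner_symm, inner_kdelta_left]
  have hnorm := norm_sq_le_norm_inner_of_resolvent_eq (isSelfAdjoint_divGrad ha).isSymmetric hu
  have henergy := mul_re_inner_le_norm_inner_of_resolvent_eq hu
  rw [hsource] at hnorm henergy
  set s := √(m * T)
  have hs : s ^ 2 = m * T := Real.sq_sqrt (by positivity)
  have hdiff : (‖backDiff u‖ * s) ^ 2 ≤ ‖u 0‖ := by
    rw [mul_pow, hs]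
    nlinarith [mul_norm_backDiff_sq_le_re_inner_divGrad ha hma u]
  have hsq : ‖u 0‖ * (‖u 0‖ * s) ≤ ‖u 0‖ * 2 :=
    calc ‖u 0‖ * (‖u 0‖ * s) = ‖u 0‖ ^ 2 * s := by ring
      _ ≤ 2 * ‖u‖ * ‖backDiff u‖ * s :=
          mul_le_mul_of_nonneg_right (norm_apply_sq_le_norm_mul_norm_backDiff u 0)
            (Real.sqrt_nonneg _)
      _ ≤ ‖u‖ ^ 2 + (‖backDiff u‖ * s) ^ 2 := by
          linarith [two_mul_le_add_sq ‖u‖ (‖backDiff u‖ * s)]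
      _ ≤ ‖u 0‖ * 2 := by linarith
  rcases (norm_nonneg (u 0)).eq_or_lt with h0 | h0
  · simp [← h0]
  · exact le_of_mul_le_mul_left hsq h0

theorem norm_sq_mul_sqrt_le_of_resolvent_eq (hm : 0 < m) (ha : ∃ C : ℝ, ∀ n, |a n| ≤ C)
    (hma : ∀ n, m ≤ a n) (hT : 0 < T) (hu : u + (Complex.I * T) • divGrad a u = kdelta 0) :
    ‖u‖ ^ 2 * √(m * T) ≤ 2 := by
  refine le_trans ?_ (norm_apply_zero_mul_sqrt_le_of_resolvent_eq hm ha hma hT hu)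
  gcongr
  simpa only [norm_inner_symm u, inner_kdelta_left] using
    norm_sq_le_norm_inner_of_resolvent_eq (isSelfAdjoint_divGrad ha).isSymmetric hu

theorem tsum_eq_one_of_resolvent_eq (ha : ∃ C : ℝ, ∀ n, |a n| ≤ C)
    (hu : u + (Complex.I * T) • divGrad a u = kdelta 0) (hsum : Summable u) : ∑' n, u n = 1 := by
  have hsource : HasSum (kdelta 0) 1 := by
    simpa only [← kdelta_apply] using hasSum_ite_eq (0 : ℤ) (1 : ℂ)
  have h : HasSum (u + (Complex.I * T) • divGrad a u : EllTwo) (∑' n, u n + Complex.I * T * 0) :=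
    hsum.hasSum.add ((hasSum_divGrad_zero ha hsum).mul_left (Complex.I * T))
  rw [hu, mul_zero, add_zero] at h
  exact h.unique hsource

theorem le_tsum_rpow_mul_norm_sq_of_resolvent_eq {q : ℝ} (hm : 0 < m)
    (ha : ∃ C : ℝ, ∀ n, |a n| ≤ C) (hma : ∀ n, m ≤ a n) (hq : 1 < q)
    (hT : 16 * carlsonConst q ^ 2 / m ≤ T) (hu : u + (Complex.I * T) • divGrad a u = kdelta 0)
    (hmoment : Summable fun n : ℤ => |(n : ℝ)| ^ q * ‖u n‖ ^ 2) :
    (√(m * T) / (4 * carlsonConst q)) ^ (q - 1) / (2 * carlsonConst q)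
      ≤ ∑' n : ℤ, |(n : ℝ)| ^ q * ‖u n‖ ^ 2 := by
  have hC : 0 < carlsonConst q := one_pos.trans_le (one_le_carlsonConst q)
  have hT0 : 0 < T := lt_of_lt_of_le (by positivity) hT
  have hR : 1 ≤ √(m * T) / (4 * carlsonConst q) := by
    rw [one_le_div (by positivity)]
    refine Real.le_sqrt_of_sq_le ?_
    rw [div_le_iff₀ hm] at hT
    linarith
  have hnorm : HasSum (fun n => ‖u n‖ ^ 2) (‖u‖ ^ 2) := by
    simpa using lp.hasSum_norm (p := 2) (by norm_num) u
  have hsum : Summable fun n => ‖u n‖ :=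
    (summable_and_tsum_sq_le_carlsonConst_mul hq hR (fun n => norm_nonneg (u n)) hnorm.summable
      hmoment).1
  have hmass : 1 ≤ ∑' n, ‖u n‖ := by
    simpa [tsum_eq_one_of_resolvent_eq ha hu hsum.of_norm] using norm_tsum_le_tsum_norm hsum
  refine rpow_sub_one_div_le_tsum_rpow_mul_sq hq hR (fun n => norm_nonneg (u n)) hnorm.summable
    hmoment hmass ?_
  have hCR : carlsonConst q * (√(m * T) / (4 * carlsonConst q)) = √(m * T) / 4 := by field_simp
  rw [hnorm.tsum_eq, hCR]
  linarith [norm_sq_mul_sqrt_le_of_resolvent_eq hm ha hma hT0 hu]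

end DivGradResolvent

section Moment

variable {a : ℤ → ℝ} {T : ℝ}

theorem timeAvgMoment_eq_lintegral_expMeasure (a : ℤ → ℝ) (q T : ℝ) :
    timeAvgMoment a q T = ∫⁻ t, ∑' n : ℤ, ENNReal.ofReal
      (|(n : ℝ)| ^ q * ‖inner ℂ (kdelta n) (evolution a t (kdelta 0))‖ ^ 2) ∂expMeasure T⁻¹ := by
  rw [lintegral_expMeasure, timeAvgMoment]
  simp only [div_eq_inv_mul, mul_neg]

theorem tsum_ofReal_rpow_mul_norm_avgWave_sq_le (ha : ∃ C : ℝ, ∀ n, |a n| ≤ C) (hT : 0 < T)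
    (q : ℝ) :
    ∑' n : ℤ, ENNReal.ofReal (|(n : ℝ)| ^ q * ‖avgWave (divGrad a) T (kdelta 0) n‖ ^ 2)
      ≤ timeAvgMoment a q T := by
  have := isProbabilityMeasure_expMeasure (inv_pos.2 hT)
  have hcont : Continuous fun t => evolution a t (kdelta 0) :=
    continuous_exp_neg_I_smul_apply (divGrad a) (kdelta 0)
  have hcoord (n : ℤ) : Continuous fun t => inner ℂ (kdelta n) (evolution a t (kdelta 0)) :=
    continuous_const.inner hcont
  have havg (n : ℤ) : avgWave (divGrad a) T (kdelta 0) n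
      = ∫ t, inner ℂ (kdelta n) (evolution a t (kdelta 0)) ∂expMeasure T⁻¹ := by
    rw [← inner_kdelta_left]
    exact (integral_inner (integrable_exp_neg_I_smul_apply (isSelfAdjoint_divGrad ha) hT _) _).symm
  have hofReal (n : ℤ) (z : ℂ) : ENNReal.ofReal (|(n : ℝ)| ^ q * ‖z‖ ^ 2)
      = ENNReal.ofReal (|(n : ℝ)| ^ q) * ‖z‖ₑ ^ 2 := by
    rw [ENNReal.ofReal_mul (by positivity), ENNReal.ofReal_pow (norm_nonneg _), ofReal_norm]
  have hmeas (n : ℤ) :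
      Measurable fun t => ‖inner ℂ (kdelta n) (evolution a t (kdelta 0))‖ₑ ^ 2 :=
    (hcoord n).measurable.enorm.pow_const 2
  rw [timeAvgMoment_eq_lintegral_expMeasure]
  simp only [hofReal]
  rw [lintegral_tsum fun n => ((hmeas n).const_mul _).aemeasurable]
  refine ENNReal.tsum_le_tsum fun n => ?_
  rw [lintegral_const_mul _ (hmeas n), havg]
  gcongr
  exact enorm_integral_sq_le_lintegral (hcoord n).aestronglyMeasurable

theorem norm_pow_divGrad_kdelta_le {A : ℝ} (hA : ∀ n, |a n| ≤ A) (k : ℕ) (n : ℤ) :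
    ‖((divGrad a) ^ k) (kdelta 0) n‖ ≤ (4 * Real.exp 1 * A) ^ k * Real.exp (-|(n : ℝ)|) := by
  have hA0 : 0 ≤ A := (abs_nonneg _).trans (hA 0)
  induction k generalizing n with
  | zero =>
    rw [pow_zero, pow_zero, one_mul, one_apply_eq_self, kdelta_apply]
    split_ifs with h
    · simp [h]
    · simpa using Real.exp_nonneg _
  | succ k ih =>
    rw [pow_succ', mul_apply_eq_comp, divGrad_apply ⟨A, hA⟩]
    refine (norm_divGradExpr_le hA (((divGrad a) ^ k) (kdelta 0)) n).trans ?_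
    set B := (4 * Real.exp 1 * A) ^ k * (Real.exp 1 * Real.exp (-|(n : ℝ)|)) with hB
    have hneighbour (j : ℤ) (hj : |(j : ℝ)| ≤ 1) :
        ‖((divGrad a) ^ k) (kdelta 0) (n + j)‖ ≤ B := by
      refine (ih (n + j)).trans (mul_le_mul_of_nonneg_left ?_ (by positivity))
      rw [← Real.exp_add, Real.exp_le_exp]
      have := abs_sub_abs_le_abs_sub (n : ℝ) (-(j : ℝ))
      rw [abs_neg, sub_neg_eq_add] at this
      push_cast
      linarith
    calc A * ‖((divGrad a) ^ k) (kdelta 0) (n + 1)‖ + 2 * A * ‖((divGrad a) ^ k) (kdelta 0) n‖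
          + A * ‖((divGrad a) ^ k) (kdelta 0) (n + -1)‖
        ≤ A * B + 2 * A * B + A * B := by
          gcongr
          · exact hneighbour 1 (by simp)
          · simpa using hneighbour 0 (by simp)
          · exact hneighbour (-1) (by simp)
      _ = (4 * Real.exp 1 * A) ^ (k + 1) * Real.exp (-|(n : ℝ)|) := by rw [hB, pow_succ]; ring

theorem norm_evolution_kdelta_le_exp {A t : ℝ} (hA : ∀ n, |a n| ≤ A) (ht : 0 ≤ t) (n : ℤ) :
    ‖evolution a t (kdelta 0) n‖ ≤ Real.exp (4 * Real.exp 1 * A * t - |(n : ℝ)|) := by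
  let L : (EllTwo →L[ℂ] EllTwo) →L[ℂ] ℂ :=
    (innerSL ℂ (kdelta n)).comp (ContinuousLinearMap.apply ℂ EllTwo (kdelta 0))
  have hL (B : EllTwo →L[ℂ] EllTwo) : L B = B (kdelta 0) n := inner_kdelta_left n _
  have hseries := L.hasSum (NormedSpace.exp_series_hasSum_exp' (𝕂 := ℂ)
    ((-(Complex.I * (t : ℂ))) • divGrad a))
  have hexp := (NormedSpace.exp_series_hasSum_exp' (𝕂 := ℝ) (4 * Real.exp 1 * A * t)).mul_right
    (Real.exp (-|(n : ℝ)|))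
  rw [← Real.exp_eq_exp_ℝ, ← Real.exp_add, ← sub_eq_add_neg] at hexp
  rw [evolution, ← hL, ← hseries.tsum_eq]
  refine tsum_of_norm_bounded hexp fun k => ?_
  rw [map_smul, smul_pow, map_smul, hL, norm_smul, norm_smul, norm_pow, norm_neg, norm_mul,
    Complex.norm_I, one_mul, Complex.norm_real, Real.norm_of_nonneg ht, norm_inv,
    RCLike.norm_natCast, smul_eq_mul, mul_pow _ t, mul_assoc, mul_comm _ (t ^ k), mul_assoc]
  gcongr
  exact norm_pow_divGrad_kdelta_le hA k n

/-- Interpolation between the ballistic bound and unitarity. A small `θ` makes the growth in `t`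
slower than the decay of the exponential time average. -/
theorem norm_evolution_kdelta_sq_le_exp {A t θ : ℝ} (hA : ∀ n, |a n| ≤ A) (ht : 0 ≤ t)
    (hθ : θ ∈ Set.Icc 0 2) (n : ℤ) :
    ‖evolution a t (kdelta 0) n‖ ^ 2
      ≤ Real.exp (θ * (4 * Real.exp 1 * A * t)) * Real.exp (-θ * |(n : ℝ)|) := by
  have hballistic := norm_evolution_kdelta_le_exp hA ht n
  rw [← Real.exp_add, neg_mul, ← sub_eq_add_neg, ← mul_sub]
  set x := 4 * Real.exp 1 * A * t - |(n : ℝ)|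
  rcases le_total 0 x with hx | hx
  · have hunit : ‖evolution a t (kdelta 0) n‖ ≤ 1 :=
      (lp.norm_apply_le_norm two_ne_zero _ n).trans_eq <|
        (norm_exp_neg_I_smul_apply (isSelfAdjoint_divGrad ⟨A, hA⟩) t _).trans (norm_kdelta 0)
    exact (pow_le_one₀ (norm_nonneg _) hunit).trans
      (Real.one_le_exp (mul_nonneg hθ.1 hx))
  · calc ‖evolution a t (kdelta 0) n‖ ^ 2 ≤ Real.exp x ^ 2 := by gcongr
      _ = Real.exp (2 * x) := by rw [← Real.exp_nat_mul, Nat.cast_two]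
      _ ≤ Real.exp (θ * x) := Real.exp_le_exp.2 (mul_le_mul_of_nonpos_right hθ.2 hx)

theorem summable_int_rpow_mul_exp_neg (q : ℝ) {θ : ℝ} (hθ : 0 < θ) :
    Summable fun n : ℤ => |(n : ℝ)| ^ q * Real.exp (-θ * |(n : ℝ)|) := by
  refine summable_int_comp_abs (f := fun x => x ^ q * Real.exp (-θ * x)) ?_
  have hdecay : (fun x : ℝ => x ^ q * Real.exp (-θ * x)) =O[atTop] fun x => x ^ (-2 : ℝ) := by
    refine ((Asymptotics.isBigO_refl (fun x : ℝ => x ^ q) atTop).mul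
      (isLittleO_exp_neg_mul_rpow_atTop hθ (-2 - q)).isBigO).congr' EventuallyEq.rfl ?_
    filter_upwards [eventually_gt_atTop 0] with x hx
    rw [← Real.rpow_add hx, add_sub_cancel]
  exact summable_of_isBigO_nat (Real.summable_nat_rpow.2 (by norm_num))
    (hdecay.comp_tendsto tendsto_natCast_atTop_atTop)

theorem timeAvgMoment_lt_top {A : ℝ} (hA : ∀ n, |a n| ≤ A) (hT : 0 < T) (q : ℝ) :
    timeAvgMoment a q T < ∞ := by
  have hA0 : 0 ≤ A := (abs_nonneg _).trans (hA 0)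
  set c := 4 * Real.exp 1 * A
  have hc : 0 ≤ c := by positivity
  set θ := (c * T + 1)⁻¹ with hθ
  have hθ0 : 0 < θ := by positivity
  have hθ1 : θ ≤ 1 := inv_le_one_of_one_le₀ (by nlinarith)
  have hθc : θ * c < T⁻¹ := by
    rw [hθ, inv_mul_eq_div, div_lt_iff₀ (by positivity), mul_add, mul_comm c,
      inv_mul_cancel_left₀ hT.ne']
    linarith [inv_pos.2 hT]
  set w : ℤ → ℝ := fun n => |(n : ℝ)| ^ q * Real.exp (-θ * |(n : ℝ)|)
  have hw : Summable w := summable_int_rpow_mul_exp_neg q hθ0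
  have hterm (t : ℝ) (ht : 0 < t) (n : ℤ) :
      |(n : ℝ)| ^ q * ‖inner ℂ (kdelta n) (evolution a t (kdelta 0))‖ ^ 2
        ≤ Real.exp (θ * c * t) * w n := by
    rw [inner_kdelta_left, mul_assoc θ, mul_left_comm]
    gcongr
    exact norm_evolution_kdelta_sq_le_exp hA ht.le ⟨hθ0.le, by linarith⟩ n
  calc timeAvgMoment a q T
      ≤ ∫⁻ t, ∑' n, ENNReal.ofReal (Real.exp (θ * c * t) * w n) ∂expMeasure T⁻¹ := by
        rw [timeAvgMoment_eq_lintegral_expMeasure]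
        refine lintegral_mono_ae ?_
        filter_upwards [ae_expMeasure_pos T⁻¹] with t ht
        exact ENNReal.tsum_le_tsum fun n => ENNReal.ofReal_le_ofReal (hterm t ht n)
    _ = (∫⁻ t, ENNReal.ofReal (Real.exp (θ * c * t)) ∂expMeasure T⁻¹)
          * ∑' n, ENNReal.ofReal (w n) := by
        rw [← lintegral_mul_const _ (by fun_prop)]
        simp only [ENNReal.ofReal_mul (Real.exp_nonneg _), ENNReal.tsum_mul_left]
    _ < ∞ := ENNReal.mul_lt_top (lintegral_exp_mul_expMeasure_lt_top hθc)
        hw.tsum_ofReal_lt_top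

theorem eventually_rpow_le_timeAvgMoment {m q : ℝ} (hm : 0 < m) (ha : ∃ C : ℝ, ∀ n, |a n| ≤ C)
    (hma : ∀ n, m ≤ a n) (hq : 1 < q) :
    ∃ c > 0, ∀ᶠ T in atTop, ENNReal.ofReal (c * T ^ ((q - 1) / 2)) ≤ timeAvgMoment a q T := by
  obtain ⟨A, hA⟩ := id ha
  have hC : 0 < carlsonConst q := one_pos.trans_le (one_le_carlsonConst q)
  refine ⟨(√m / (4 * carlsonConst q)) ^ (q - 1) / (2 * carlsonConst q), by positivity, ?_⟩
  filter_upwards [eventually_ge_atTop (16 * carlsonConst q ^ 2 / m), eventually_gt_atTop 0]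
    with T hT hT0
  have hjensen := tsum_ofReal_rpow_mul_norm_avgWave_sq_le ha hT0 q
  have hnonneg (n : ℤ) : 0 ≤ |(n : ℝ)| ^ q * ‖avgWave (divGrad a) T (kdelta 0) n‖ ^ 2 := by
    positivity
  have hsum : Summable fun n : ℤ =>
      |(n : ℝ)| ^ q * ‖avgWave (divGrad a) T (kdelta 0) n‖ ^ 2 := by
    have h := ENNReal.summable_toReal (hjensen.trans_lt (timeAvgMoment_lt_top hA hT0 q)).ne
    simpa only [ENNReal.toReal_ofReal (hnonneg _)] using h
  rw [← ENNReal.ofReal_tsum_of_nonneg hnonneg hsum] at hjensen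
  refine le_trans (ENNReal.ofReal_le_ofReal (le_of_eq_of_le ?_ <|
    le_tsum_rpow_mul_norm_sq_of_resolvent_eq hm ha hma hq hT
      (avgWave_add_smul_apply (isSelfAdjoint_divGrad ha) hT0 _) hsum)) hjensen
  rw [Real.sqrt_mul hm.le, mul_div_right_comm, Real.mul_rpow (by positivity) (by positivity),
    Real.sqrt_eq_rpow T, ← Real.rpow_mul hT0.le]
  ring_nf

end Moment

theorem le_liminf_log_div_log {F : ℝ → ℝ≥0∞} {c s q : ℝ} (hc : 0 < c) (hq : 0 < q)
    (hF : ∀ᶠ T in atTop, ENNReal.ofReal (c * T ^ s) ≤ F T) :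
    ((s / q : ℝ) : EReal)
      ≤ liminf (fun T : ℝ => ENNReal.log (F T) / ((q * Real.log T : ℝ) : EReal)) atTop := by
  have hlim : Tendsto (fun T => Real.log (c * T ^ s) / (q * Real.log T)) atTop (nhds (s / q)) := by
    have hsplit : (fun T => Real.log (c * T ^ s) / (q * Real.log T))
        =ᶠ[atTop] fun T => Real.log c / q * (Real.log T)⁻¹ + s / q := by
      filter_upwards [eventually_gt_atTop 1] with T hT
      have hlog := Real.log_pos hT
      have hT0 := one_pos.trans hT
      rw [Real.log_mul hc.ne' (Real.rpow_pos_of_pos hT0 s).ne', Real.log_rpow hT0]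
      field_simp
    refine Tendsto.congr' hsplit.symm ?_
    simpa using (Real.tendsto_log_atTop.inv_tendsto_atTop.const_mul (Real.log c / q)).add_const
      (s / q)
  rw [← (continuous_coe_real_ereal.tendsto _ |>.comp hlim).liminf_eq]
  refine liminf_le_liminf ?_
  filter_upwards [hF, eventually_gt_atTop 1] with T hT hT1
  have hlog : 0 ≤ q * Real.log T := mul_nonneg hq.le (Real.log_pos hT1).le
  have hpos : 0 < c * T ^ s := mul_pos hc (Real.rpow_pos_of_pos (one_pos.trans hT1) s)
  rw [Function.comp_apply, EReal.coe_div, ← ENNReal.log_ofReal_of_pos hpos]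
  exact EReal.div_le_div_right_of_nonneg (EReal.coe_nonneg.2 hlog) (ENNReal.log_le_log hT)

theorem ae_forall_mem_Icc_of_map_eq {Ω ι : Type*} [MeasurableSpace Ω] [Countable ι] {P : Measure Ω}
    {P₀ : Measure ℝ} {X : ι → Ω → ℝ} (hX : ∀ i, Measurable (X i)) (hlaw : ∀ i, P.map (X i) = P₀)
    (hbelow : BddBelow P₀.support) (habove : BddAbove P₀.support) :
    ∀ᵐ ω ∂P, ∀ i, X i ω ∈ Set.Icc (sInf P₀.support) (sSup P₀.support) := by
  refine ae_all_iff.2 fun i => ?_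
  have hsupp : ∀ᵐ x ∂P.map (X i), x ∈ P₀.support := hlaw i ▸ Measure.support_mem_ae
  filter_upwards [ae_of_ae_map (hX i).aemeasurable hsupp] with ω hω
  exact ⟨csInf_le hbelow hω, le_csSup habove hω⟩

theorem theorem1p2_general {a : ℤ → ℝ} {m A q : ℝ} (hm : 0 < m) (ha : ∀ n, a n ∈ Set.Icc m A)
    (hq : 1 < q) :
    (∀ T : ℝ, 0 < T → timeAvgMoment a q T < ∞) ∧
      ((1 / 2 - 1 / (2 * q) : ℝ) : EReal) ≤
        liminf (fun T : ℝ =>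
          ENNReal.log (timeAvgMoment a q T) / ((q * Real.log T : ℝ) : EReal)) atTop := by
  have hA (n : ℤ) : |a n| ≤ A := by
    rw [abs_of_pos (hm.trans_le (ha n).1)]
    exact (ha n).2
  have hq0 : 0 < q := one_pos.trans hq
  refine ⟨fun T hT => timeAvgMoment_lt_top hA hT q, ?_⟩
  obtain ⟨c, hc, hmoment⟩ := eventually_rpow_le_timeAvgMoment hm ⟨A, hA⟩ (fun n => (ha n).1) hq
  have hexponent : (q - 1) / 2 / q = 1 / 2 - 1 / (2 * q) := by field_simp
  exact hexponent ▸ le_liminf_log_div_log hc hq0 hmoment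

theorem theorem1p2 {Ω : Type*} [MeasurableSpace Ω] (P : Measure Ω) [IsProbabilityMeasure P]
    (P₀ : Measure ℝ) [IsProbabilityMeasure P₀]
    (a : ℤ → Ω → ℝ) (ha_meas : ∀ n, Measurable (a n))
    (ha_indep : iIndepFun a P) (ha_law : ∀ n, P.map (a n) = P₀)
    (h_pos : 0 < sInf P₀.support) (h_nontriv : sInf P₀.support < sSup P₀.support)
    (h_bdd : BddAbove P₀.support)
    (q : ℝ) (hq : 11 / 2 ≤ q) :
    ∀ᵐ ω ∂P,
      (∀ T : ℝ, 0 < T → timeAvgMoment (fun n => a n ω) q T < ∞) ∧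
      ((2 / 5 - 11 / (5 * q) : ℝ) : EReal) ≤
        liminf (fun T : ℝ =>
          ENNReal.log (timeAvgMoment (fun n => a n ω) q T) / ((q * Real.log T : ℝ) : EReal))
          atTop := by
  have hbelow : BddBelow P₀.support := by
    by_contra h
    exact h_pos.ne' (Real.sInf_of_not_bddBelow h)
  filter_upwards [ae_forall_mem_Icc_of_map_eq ha_meas ha_law hbelow h_bdd] with ω hω
  refine (theorem1p2_general h_pos hω (by linarith)).imp_right (le_trans ?_)
  have hq0 : 0 < q := by linarith
  rw [EReal.coe_le_coe_iff]
  field_simp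
  linarith
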